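/- Let $n\in\mathbb{N}$, let $M$ be the set of all Lebesgue measurable functions $f:\mathbb{R}^n\to[0,1]$ (functions, not classes modulo null sets) with the supremum metric $d_\infty$, let $K:\mathbb{R}^n\to\mathbb{R}$ be in $L^1$ and let $G:\mathbb{R}\to\mathbb{R}$ be bounded and Lipschitz. The Lenia arc field is the map $X:M\times[0,1]\to M$, $$X_t(f)(x)=\bigl[f(x)+t\,G\bigl((K*f)(x)\bigr)\bigr]_0^1,\qquad (K*f)(x)=\int_{\mathbb{R}^n}K(x-y)f(y)\,dy,\qquad [u]_0^1=\max\{0,\min\{1,u\}\}.$$ In general, an arc field on a metric space $N$ is a continuous map $Y:N\times[0,1]\to N$ with $Y_0(f)=f$ for all $f$. A flow of $Y$ is a continuous map $F:N\times[0,\infty)\to N$ with $F_0(f)=f$, $F_t(F_s(f))=F_{s+t}(f)$ and $\lim_{h\to0^+}d(F_{t+h}(f),Y_h(F_t(f)))/h=0$ for all $f\in N$ and $s,t\ge 0$. **Proposition (continuity is preserved).** $X$ is an arc field on $M$. It has exactly one flow $F$, and $F_t(f)=\lim_{k\to\infty}X_{t/k}^{(k)}(f)$ in $d_\infty$ for all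 $f\in M$ and $t\ge0$, where $X_{t/k}^{(k)}$ is the $k$-fold composition of $X_{t/k}$ (defined for $k\ge \max\{t,1\}$). If $f_0\in M$ is continuous, then the Lenia solution $f_t:=F_t(f_0)$ is continuous for all $t>0$. Moreover, the set $C(\mathbb{R}^n,[0,1])$ of continuous functions is closed in $M$; $X$ maps $C(\mathbb{R}^n,[0,1])\times[0,1]$ into $C(\mathbb{R}^n,[0,1])$ and restricts to an arc field on it; and if $f_0\in C(\mathbb{R}^n,[0,1])$, $t\ge0$ and the Euler approximations $X_{t/k}^{(k)}(f_0)$ converge in $M$ to some $g$ as $k\to\infty$, then $g\in C(\mathbb{R}^n,[0,1])$. -/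

import Mathlib

open MeasureTheory Filter Topology
open scoped NNReal unitInterval

namespace Lenia

section ArcFields

/-- An arc field on a metric space: a (jointly) continuous map `X : M × [0,1] → M`
with `X₀(f) = f`. -/
structure IsArcField {M : Type*} [MetricSpace M] (X : M → I → M) : Prop where
  continuous : Continuous (fun p : M × I => X p.1 p.2)
  zero : ∀ f, X f 0 = f

/-- A forward flow on a metric space: a (jointly) continuous map `F : M × [0,∞) → M` with
`F₀(f) = f` and `F_t(F_s(f)) = F_{s+t}(f)`. -/
structure IsFlow {M : Type*} [MetricSpace M] (F : M → ℝ≥0 → M) : Prop where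
  continuous : Continuous (fun p : M × ℝ≥0 => F p.1 p.2)
  zero : ∀ f, F f 0 = f
  add : ∀ f s t, F (F f s) t = F f (s + t)

/-- `F` is a flow of the arc field `X`: a forward flow that is forward tangent to `X`,
i.e. `d(F_{t+h}(f), X_h(F_t(f))) / h → 0` as `h → 0⁺`, for all `t ≥ 0` and all `f`. -/
structure IsFlowOf {M : Type*} [MetricSpace M] (X : M → I → M) (F : M → ℝ≥0 → M) : Prop
    extends IsFlow F where
  tangent : ∀ f t, Tendsto
    (fun h : I => dist (F f (t + unitInterval.toNNReal h)) (X (F f t) h) / (h : ℝ))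
    (𝓝[>] 0) (𝓝 0)

/-- The Euler approximation `X_{t/n}^{(n)}(f)`: the `n`-fold composition of `X_{t/n}`, applied
to `f`. The step `t/n` lies in `[0,1]` as soon as `n ≥ t` (for the finitely many smaller `n` it is
truncated to `1`, which is irrelevant to the limit `n → ∞`). -/
noncomputable def euler {M : Type*} (X : M → I → M) (t : ℝ≥0) (n : ℕ) (f : M) : M :=
  (fun g => X g (Set.projIcc 0 1 zero_le_one ((t : ℝ) / n)))^[n] f

/-- The arc field `X` restricts to the subset `C` of `M`: it maps `C × [0,1]` into `C`, and the
resulting map is an arc field on `C`. -/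
def RestrictsTo {M : Type*} [MetricSpace M] (X : M → I → M) (C : Set M) : Prop :=
  ∃ Y : C → I → C, IsArcField Y ∧ ∀ (f : C) (t : I), (Y f t : M) = X f t

end ArcFields

/-- The state space `M = 𝓑(ℝⁿ, [0,1])`: all Lebesgue measurable functions `ℝⁿ → [0,1]` (functions,
not classes modulo null sets). As a subtype of `UniformFun` it carries the supremum metric. -/
abbrev State (n : ℕ) : Type :=
  {f : UniformFun (EuclideanSpace ℝ (Fin n)) I // NullMeasurable (UniformFun.toFun f) volume}

namespace State

variable {n : ℕ}

/-- The underlying function `ℝⁿ → [0,1]` of a state. -/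
def fn (f : State n) : EuclideanSpace ℝ (Fin n) → I := UniformFun.toFun f.1

/-- The metric of `State n` is the supremum metric. -/
theorem dist_eq (f g : State n) : dist f g = ⨆ x, |(f.fn x : ℝ) - (g.fn x : ℝ)| := rfl

end State

/-- The convolution `(K ∗ f)(x) = ∫ K(x - y) f(y) dy`. -/
noncomputable def conv {n : ℕ} (K : EuclideanSpace ℝ (Fin n) → ℝ) (f : State n)
    (x : EuclideanSpace ℝ (Fin n)) : ℝ :=
  ∫ y, K (x - y) * (f.fn y : ℝ)

theorem aemeasurable_fn {n : ℕ} (f : State n) :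
    AEMeasurable (fun y => (f.fn y : ℝ)) volume :=
  measurable_subtype_coe.comp_aemeasurable (NullMeasurable.aemeasurable f.2)

theorem measurable_conv {n : ℕ} {K : EuclideanSpace ℝ (Fin n) → ℝ} (hK : Integrable K)
    (f : State n) : Measurable (conv K f) := by
  have hf := aemeasurable_fn f
  have hK' := hK.1.aemeasurable
  have key : conv K f = fun x => ∫ y, hK'.mk K (x - y) * hf.mk _ y := by
    funext x
    refine integral_congr_ae ?_
    have h1 : ∀ᵐ y, K (x - y) = hK'.mk K (x - y) :=
      (quasiMeasurePreserving_sub_left volume x).ae hK'.ae_eq_mk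
    filter_upwards [h1, hf.ae_eq_mk] with y h2 h3
    rw [h2, h3]
  rw [key]
  refine StronglyMeasurable.measurable (StronglyMeasurable.integral_prod_right' (f := fun p :
    EuclideanSpace ℝ (Fin n) × EuclideanSpace ℝ (Fin n) =>
      hK'.mk K (p.1 - p.2) * hf.mk _ p.2) ?_)
  exact ((hK'.measurable_mk.comp (measurable_fst.sub measurable_snd)).mul
    (hf.measurable_mk.comp measurable_snd)).stronglyMeasurable

theorem nullMeasurable_step {n : ℕ} {K : EuclideanSpace ℝ (Fin n) → ℝ} (hK : Integrable K)
    {G : ℝ → ℝ} (hG : Continuous G) (f : State n) (t : I) :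
    NullMeasurable (fun x => (Set.projIcc 0 1 zero_le_one
      ((f.fn x : ℝ) + (t : ℝ) * G (conv K f x)) : I)) volume := by
  have h : AEMeasurable (fun x => (f.fn x : ℝ) + (t : ℝ) * G (conv K f x)) volume :=
    (aemeasurable_fn f).add
      ((hG.measurable.comp (measurable_conv hK f)).const_mul (t : ℝ)).aemeasurable
  have hp : Measurable (Set.projIcc (0 : ℝ) 1 zero_le_one) := continuous_projIcc.measurable
  exact (hp.comp_aemeasurable h).nullMeasurable

/-- The Lenia arc field `X_t(f)(x) = [f(x) + t G((K ∗ f)(x))]₀¹`, where `[·]₀¹` is the clip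
function, i.e. the projection of `ℝ` onto `[0,1]`. -/
noncomputable def arcField {n : ℕ} (K : EuclideanSpace ℝ (Fin n) → ℝ) (hK : Integrable K)
    (G : ℝ → ℝ) (hG : Continuous G) (f : State n) (t : I) : State n :=
  ⟨UniformFun.ofFun fun x =>
      Set.projIcc 0 1 zero_le_one ((f.fn x : ℝ) + (t : ℝ) * G (conv K f x)),
    nullMeasurable_step hK hG f t⟩

/-- The set `C(ℝⁿ, [0,1])` of continuous states. -/
def continuousStates (n : ℕ) : Set (State n) := {f | Continuous f.fn}

end Lenia

/-!
The defect of `X_{s+t} = X_t ∘ X_s` is of second order, `O(st)`: clipping twice along a frozen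
velocity is the same as clipping once, so only the variation of `G ∘ (K ∗ f)` along the step
matters, and `G` is Lipschitz on the ball of radius `‖K‖₁`, where `K ∗ f` takes its values. As each
`X_t` expands distances by at most `1 + Λt`, one step of length `r` and `m` steps of length `r / m`
differ by `O(r²)`, and the errors of `k` steps of length `t / k` add up to `O(t² / k)` for bounded
`t`. Comparing the approximations with `k` and `j` steps to the one with `jk` steps shows that they
form a Cauchy sequence. The limit is jointly continuous, and it is also the limit of `X_h^{⌊t/h⌋}`
as `h → 0⁺`, uniformly enough to compose two such limits, which gives the semigroup law. Uniqueness
is Grönwall's inequality for the distance between two solution curves. Finally, a closed set mapped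
into itself by every `X_t` contains the limits of its Euler approximations; the continuous states
form such a set because `K ∗ f` is continuous for bounded continuous `f`.
-/

namespace Lenia

open unitInterval (toNNReal)

section Iteration

theorem one_add_mul_pow_le_exp {x y : ℝ} (hx : 0 ≤ x) (hy : 0 ≤ y) (m : ℕ) :
    (1 + x * y) ^ m ≤ Real.exp (x * (m * y)) := by
  calc (1 + x * y) ^ m ≤ Real.exp (x * y) ^ m := by
        gcongr
        linarith [Real.add_one_le_exp (x * y)]
    _ = Real.exp (x * (m * y)) := by rw [← Real.exp_nat_mul]; ring_nf

theorem dist_iterate_iterate_le {M : Type*} [PseudoMetricSpace M] {Φ Ψ : M → M} {q : ℝ≥0} {δ : ℝ}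
    (hq : 1 ≤ q) (hΨ : LipschitzWith q Ψ) (hδ : ∀ x, dist (Φ x) (Ψ x) ≤ δ) (m : ℕ) (x y : M) :
    dist (Φ^[m] x) (Ψ^[m] y) ≤ q ^ m * (dist x y + m * δ) := by
  have hδ0 : 0 ≤ δ := dist_nonneg.trans (hδ x)
  induction m with
  | zero => simp
  | succ m ih =>
    have hq' : (1 : ℝ) ≤ q ^ (m + 1) := one_le_pow₀ hq
    rw [Function.iterate_succ_apply', Function.iterate_succ_apply']
    calc dist (Φ (Φ^[m] x)) (Ψ (Ψ^[m] y))
        ≤ dist (Φ (Φ^[m] x)) (Ψ (Φ^[m] x)) + dist (Ψ (Φ^[m] x)) (Ψ (Ψ^[m] y)) :=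
          dist_triangle _ _ _
      _ ≤ q ^ (m + 1) * δ + q * (q ^ m * (dist x y + m * δ)) :=
          add_le_add ((hδ _).trans (le_mul_of_one_le_left hδ0 hq'))
            ((hΨ.dist_le_mul _ _).trans (by gcongr))
      _ = q ^ (m + 1) * (dist x y + (m + 1 : ℕ) * δ) := by push_cast; ring

end Iteration

section UnitInterval

instance neBot_nhdsGT_zero : (𝓝[>] (0 : I)).NeBot :=
  nhdsGT_neBot_of_exists_gt ⟨1, zero_lt_one⟩

theorem tendsto_add_coe_nhdsGT (x : ℝ) : Tendsto (fun h : I => x + h) (𝓝[>] 0) (𝓝[>] x) := by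
  refine tendsto_nhdsWithin_iff.2 ⟨?_, ?_⟩
  · have hc : Continuous fun h : I => x + h := by fun_prop
    exact (hc.tendsto' 0 x (by simp)).mono_left nhdsWithin_le_nhds
  · filter_upwards [self_mem_nhdsWithin] with h (hh : (0 : ℝ) < h)
    exact lt_add_of_pos_right x hh

theorem coe_projIcc_eq {u : ℝ} (hu : u ∈ I) : (Set.projIcc 0 1 zero_le_one u : ℝ) = u :=
  congrArg Subtype.val (Set.projIcc_of_mem zero_le_one hu)

theorem dist_projIcc_le (u v : ℝ) :
    dist (Set.projIcc (0 : ℝ) 1 zero_le_one u) (Set.projIcc (0 : ℝ) 1 zero_le_one v) ≤ dist u v :=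
  Set.abs_projIcc_sub_projIcc zero_le_one

theorem tendsto_floor_div_mul (t : ℝ≥0) :
    Tendsto (fun h : I => (⌊(t : ℝ) / h⌋₊ * toNNReal h : ℝ≥0)) (𝓝[>] 0) (𝓝 t) := by
  have hinv : Tendsto (fun h : I => (h : ℝ)⁻¹) (𝓝[>] 0) atTop := by
    refine tendsto_inv_nhdsGT_zero.comp ?_
    simpa using tendsto_add_coe_nhdsGT 0
  refine NNReal.tendsto_coe.1 ?_
  simpa [Function.comp_def, div_eq_mul_inv] using (tendsto_nat_floor_mul_div_atTop t.2).comp hinv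

end UnitInterval

section Euler

variable {M : Type*} {X : M → I → M}

theorem euler_natCast_mul (X : M → I → M) (m : ℕ) (h : I) (f : M) :
    euler X (m * toNNReal h) m f = (fun g => X g h)^[m] f := by
  obtain rfl | hm := eq_or_ne m 0
  · rfl
  have hstep : ((m * toNNReal h : ℝ≥0) : ℝ) / m = h := by
    push_cast
    exact mul_div_cancel_left₀ _ (Nat.cast_ne_zero.2 hm)
  rw [euler, hstep, Set.projIcc_val]

theorem euler_mem {C : Set M} (hX : ∀ f ∈ C, ∀ t, X f t ∈ C) {f : M} (hf : f ∈ C) (t : ℝ≥0)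
    (k : ℕ) : euler X t k f ∈ C :=
  Set.MapsTo.iterate (s := C) (fun g hg => hX g hg _) k hf

theorem mem_of_tendsto_euler [TopologicalSpace M] {C : Set M} (hC : IsClosed C)
    (hX : ∀ f ∈ C, ∀ t, X f t ∈ C) {f g : M} (hf : f ∈ C) {t : ℝ≥0}
    (hg : Tendsto (fun k => euler X t k f) atTop (𝓝 g)) : g ∈ C :=
  hC.mem_of_tendsto hg (Eventually.of_forall (euler_mem hX hf t))

end Euler

section Restriction

variable {M : Type*} [MetricSpace M] {X : M → I → M} {C : Set M}

theorem IsArcField.restrictsTo (hX : IsArcField X) (hC : ∀ f ∈ C, ∀ t, X f t ∈ C) :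
    RestrictsTo X C := by
  refine ⟨fun f t => ⟨X f t, hC f f.2 t⟩, ⟨?_, fun f => Subtype.ext (hX.zero f)⟩, fun _ _ => rfl⟩
  have hval : Continuous fun p : C × I => ((p.1 : M), p.2) := by fun_prop
  exact (hX.continuous.comp hval).subtype_mk _

end Restriction

section Solutions

variable {M : Type*} [MetricSpace M] {X : M → I → M}

/-- A solution curve of `X`: a continuous curve that is forward tangent to `X` at all times. -/
structure IsSolution (X : M → I → M) (γ : ℝ≥0 → M) : Prop where
  continuous : Continuous γ
  tangent : ∀ t, Tendsto
    (fun h : I => dist (γ (t + toNNReal h)) (X (γ t) h) / (h : ℝ)) (𝓝[>] 0) (𝓝 0)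

theorem IsFlowOf.isSolution {F : M → ℝ≥0 → M} (hF : IsFlowOf X F) (f : M) :
    IsSolution X (F f) where
  continuous := hF.continuous.comp (Continuous.prodMk_right f)
  tangent := hF.tangent f

variable {Λ : ℝ≥0} {γ η : ℝ≥0 → M}

theorem IsSolution.eventually_slope_dist_lt
    (hX : ∀ h : I, LipschitzWith (1 + Λ * toNNReal h) fun f => X f h)
    (hγ : IsSolution X γ) (hη : IsSolution X η) (t : ℝ≥0) {r : ℝ} (hr : Λ * dist (γ t) (η t) < r) :
    ∀ᶠ h : I in 𝓝[>] 0, (h : ℝ)⁻¹ * (dist (γ (t + toNNReal h))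
      (η (t + toNNReal h)) - dist (γ t) (η t)) < r := by
  have hε : 0 < (r - Λ * dist (γ t) (η t)) / 2 := by linarith
  filter_upwards [(hγ.tangent t).eventually_lt_const hε, (hη.tangent t).eventually_lt_const hε,
    self_mem_nhdsWithin] with h hγh hηh (hh : (0 : ℝ) < h)
  rw [div_lt_iff₀ hh] at hγh hηh
  rw [inv_mul_lt_iff₀ hh]
  have hgrowth : dist (X (γ t) h) (X (η t) h) ≤ (1 + Λ * h) * dist (γ t) (η t) :=
    (hX h).dist_le_mul _ _
  have htriangle := dist_triangle4 (γ (t + toNNReal h)) (X (γ t) h) (X (η t) h)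
    (η (t + toNNReal h))
  rw [dist_comm (X (η t) h)] at htriangle
  linarith

theorem IsSolution.dist_le
    (hX : ∀ h : I, LipschitzWith (1 + Λ * toNNReal h) fun f => X f h)
    (hγ : IsSolution X γ) (hη : IsSolution X η) (t : ℝ≥0) :
    dist (γ t) (η t) ≤ dist (γ 0) (η 0) * Real.exp (Λ * t) := by
  set φ : ℝ → ℝ := fun x => dist (γ x.toNNReal) (η x.toNNReal)
  have hφ : Continuous φ :=
    (hγ.continuous.comp continuous_real_toNNReal).dist (hη.continuous.comp continuous_real_toNNReal)
  have hslope : ∀ x ∈ Set.Ico 0 (t : ℝ), ∀ r, Λ * φ x < r →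
      ∃ᶠ z in 𝓝[>] x, (z - x)⁻¹ * (φ z - φ x) < r := fun x hx r hr => by
    refine (tendsto_add_coe_nhdsGT x).frequently (Eventually.frequently ?_)
    filter_upwards [hγ.eventually_slope_dist_lt hX hη x.toNNReal hr] with h hh
    have hadd : (x + h).toNNReal = x.toNNReal + toNNReal h := by
      rw [Real.toNNReal_add hx.1 h.2.1]
      exact congrArg _ (Real.toNNReal_coe (r := toNNReal h))
    simpa only [φ, hadd, add_sub_cancel_left] using hh
  have hgronwall := le_gronwallBound_of_liminf_deriv_right_le (δ := φ 0) (K := Λ) (ε := 0)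
    hφ.continuousOn hslope le_rfl (fun x _ => (add_zero _).ge) t ⟨t.2, le_rfl⟩
  simpa [φ, gronwallBound_ε0] using hgronwall

theorem IsFlowOf.eq_of_lipschitzWith
    (hX : ∀ h : I, LipschitzWith (1 + Λ * toNNReal h) fun f => X f h)
    {F F' : M → ℝ≥0 → M} (hF : IsFlowOf X F) (hF' : IsFlowOf X F') : F = F' := by
  funext f t
  have hle := (hF.isSolution f).dist_le hX (hF'.isSolution f) t
  rw [hF.zero, hF'.zero, dist_self, zero_mul] at hle
  exact dist_le_zero.1 hle

end Solutions

section Regular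

variable {M : Type*} [MetricSpace M] {X : M → I → M} {Λ Ω B : ℝ≥0}

/-- Uniform estimates under which the Euler approximations of `X` converge: the time-`t` map expands
distances by at most `1 + Λ t`, the curves `t ↦ X f t` have speed at most `B`, and `X` fails to
be a semigroup only to second order. -/
structure IsRegular (X : M → I → M) (Λ Ω B : ℝ≥0) : Prop where
  zero : ∀ f, X f 0 = f
  lipschitz_state : ∀ t : I, LipschitzWith (1 + Λ * toNNReal t) fun f => X f t
  lipschitz_time : ∀ f, LipschitzWith B (X f)
  dist_add_le : ∀ f (s t r : I), (r : ℝ) = s + t → dist (X f r) (X (X f s) t) ≤ Ω * (s * t)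

/-- `F` is the pointwise limit of the Euler approximations of `X`. -/
def IsEulerLimit (X : M → I → M) (F : M → ℝ≥0 → M) : Prop :=
  ∀ f t, Tendsto (fun k => euler X t k f) atTop (𝓝 (F f t))

namespace IsRegular

theorem isArcField (hX : IsRegular X Λ Ω B) : IsArcField X where
  zero := hX.zero
  continuous := by
    refine continuous_prod_of_continuous_lipschitzWith _ (1 + Λ)
      (fun f => (hX.lipschitz_time f).continuous) fun t => (hX.lipschitz_state t).weaken ?_
    gcongr
    exact mul_le_of_le_one_right' t.2.2

theorem euler_zero (hX : IsRegular X Λ Ω B) (k : ℕ) (f : M) : euler X 0 k f = f := by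
  simpa [euler] using Function.iterate_fixed (hX.zero f) k

theorem dist_euler_le (hX : IsRegular X Λ Ω B) (f g : M) (s t : ℝ≥0) (k : ℕ) :
    dist (euler X s k f) (euler X t k g) ≤
      Real.exp (Λ * t) * (dist f g + B * |(s : ℝ) - t|) := by
  set a : I := Set.projIcc 0 1 zero_le_one ((s : ℝ) / k)
  set b : I := Set.projIcc 0 1 zero_le_one ((t : ℝ) / k)
  have hcancel : ∀ x : ℝ, 0 ≤ x → k * (x / k) ≤ x := fun x hx => by
    rw [mul_div_left_comm]
    exact mul_le_of_le_one_right hx (div_self_le_one _)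
  have hb : (k * b : ℝ) ≤ t := by
    refine le_trans ?_ (hcancel t t.2)
    gcongr
    exact (Set.coe_projIcc ..).trans_le (max_le (by positivity) (min_le_right _ _))
  have hab : k * dist a b ≤ |(s : ℝ) - t| := by
    refine le_trans ?_ (hcancel _ (abs_nonneg _))
    gcongr
    refine (dist_projIcc_le _ _).trans_eq ?_
    rw [Real.dist_eq, ← sub_div, abs_div, Nat.abs_cast]
  have hiter := dist_iterate_iterate_le (le_add_of_nonneg_right zero_le) (hX.lipschitz_state b)
    (fun x => (hX.lipschitz_time x).dist_le_mul a b) k f g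
  calc dist (euler X s k f) (euler X t k g)
      ≤ (1 + Λ * b) ^ k * (dist f g + k * (B * dist a b)) := hiter
    _ ≤ Real.exp (Λ * (k * b)) * (dist f g + B * (k * dist a b)) := by
        rw [mul_left_comm (k : ℝ)]
        gcongr
        exact one_add_mul_pow_le_exp Λ.2 b.2.1 k
    _ ≤ Real.exp (Λ * t) * (dist f g + B * |(s : ℝ) - t|) := by gcongr

theorem dist_iterate_step_le (hX : IsRegular X Λ Ω B) (f : M) {h : I} (m : ℕ) {r : I}
    (hr : (r : ℝ) = m * h) :
    dist (X f r) ((fun g => X g h)^[m] f) ≤ Real.exp (Λ * r) * (Ω * r ^ 2) := by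
  induction m generalizing r with
  | zero =>
    obtain rfl : r = 0 := Subtype.ext (by simpa using hr)
    simp [hX.zero]
  | succ m ih =>
    have hh : (0 : ℝ) ≤ h := h.2.1
    have hmh : (m * h : ℝ) ∈ I :=
      ⟨by positivity, le_trans (by push_cast at hr; linarith) r.2.2⟩
    obtain ⟨r', hr'⟩ : ∃ r' : I, (r' : ℝ) = m * h := ⟨⟨_, hmh⟩, rfl⟩
    have hr0 : (0 : ℝ) ≤ r' := r'.2.1
    have hsum : (r : ℝ) = r' + h := by rw [hr, hr']; push_cast; ring
    have hexp : (1 + Λ * h : ℝ) ≤ Real.exp (Λ * h) := by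
      linarith [Real.add_one_le_exp (Λ * h : ℝ)]
    rw [Function.iterate_succ_apply']
    calc dist (X f r) (X ((fun g => X g h)^[m] f) h)
        ≤ dist (X f r) (X (X f r') h) + dist (X (X f r') h) (X ((fun g => X g h)^[m] f) h) :=
          dist_triangle _ _ _
      _ ≤ Ω * (r' * h) + (1 + Λ * h) * (Real.exp (Λ * r') * (Ω * r' ^ 2)) :=
          add_le_add (hX.dist_add_le f r' h r hsum)
            (((hX.lipschitz_state h).dist_le_mul _ _).trans
              (mul_le_mul_of_nonneg_left (ih hr') (by positivity)))
      _ ≤ Real.exp (Λ * r) * (Ω * (r' * h)) +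
            Real.exp (Λ * h) * (Real.exp (Λ * r') * (Ω * r' ^ 2)) :=
          add_le_add (le_mul_of_one_le_left (by positivity)
            (Real.one_le_exp (mul_nonneg Λ.2 r.2.1))) (by gcongr)
      _ = Real.exp (Λ * r) * (Ω * (r' * h + r' ^ 2)) := by
          rw [hsum, mul_add (Λ : ℝ), Real.exp_add]; ring
      _ ≤ Real.exp (Λ * r) * (Ω * r ^ 2) := by
          gcongr
          rw [hsum]
          nlinarith [mul_nonneg hr0 hh]

theorem dist_iterate_refine_le (hX : IsRegular X Λ Ω B) (f : M) {h r : I} {m : ℕ}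
    (hr : (r : ℝ) = m * h) (N : ℕ) :
    dist ((fun g => X g r)^[N] f) ((fun g => X g h)^[m * N] f) ≤
      Real.exp (Λ * (N * r + 1)) * (Ω * (N * r) * r) := by
  set q : ℝ≥0 := (1 + Λ * toNNReal h) ^ m
  have hq : (q : ℝ) ≤ Real.exp (Λ * r) := by
    rw [hr]
    exact one_add_mul_pow_le_exp Λ.2 h.2.1 m
  have hiter := dist_iterate_iterate_le (one_le_pow₀ (le_add_of_nonneg_right zero_le))
    ((hX.lipschitz_state h).iterate m) (fun g => hX.dist_iterate_step_le g m hr) N f f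
  rw [Function.iterate_mul]
  calc _ ≤ _ := hiter
    _ = (q : ℝ) ^ N * (N * (Real.exp (Λ * r) * (Ω * r ^ 2))) := by rw [dist_self, zero_add]
    _ ≤ Real.exp (Λ * r) ^ N * (N * (Real.exp (Λ * 1) * (Ω * r ^ 2))) := by
        gcongr
        exact r.2.2
    _ = Real.exp (Λ * (N * r + 1)) * (Ω * (N * r) * r) := by
        rw [← Real.exp_nat_mul, mul_add (Λ : ℝ), Real.exp_add, mul_left_comm (Λ : ℝ)]
        ring

theorem dist_euler_mul_le (hX : IsRegular X Λ Ω B) (f : M) {t : ℝ≥0} {k j : ℕ} (hk : k ≠ 0)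
    (hj : j ≠ 0) (ht : (t : ℝ) ≤ k) :
    dist (euler X t k f) (euler X t (j * k) f) ≤
      Real.exp (Λ * (t + 1)) * (Ω * t * (t / k)) := by
  have hk' : (0 : ℝ) < k := by positivity
  have hj' : (1 : ℝ) ≤ j := by exact_mod_cast Nat.one_le_iff_ne_zero.2 hj
  have hcoarse : (Set.projIcc 0 1 zero_le_one ((t : ℝ) / k) : ℝ) = t / k :=
    coe_projIcc_eq ⟨by positivity, div_le_one_of_le₀ ht hk'.le⟩
  have hfine : (Set.projIcc 0 1 zero_le_one ((t : ℝ) / (j * k : ℕ)) : ℝ) = t / (j * k : ℕ) := by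
    refine coe_projIcc_eq ⟨by positivity, div_le_one_of_le₀ ?_ (by positivity)⟩
    push_cast
    exact ht.trans (le_mul_of_one_le_left hk'.le hj')
  have hrefine := hX.dist_iterate_refine_le f (m := j)
    (r := Set.projIcc 0 1 zero_le_one ((t : ℝ) / k))
    (h := Set.projIcc 0 1 zero_le_one ((t : ℝ) / (j * k : ℕ)))
    (by rw [hcoarse, hfine]; push_cast; field_simp) k
  rwa [hcoarse, mul_div_cancel₀ _ hk'.ne'] at hrefine

theorem cauchySeq_euler (hX : IsRegular X Λ Ω B) (f : M) (t : ℝ≥0) :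
    CauchySeq fun k => euler X t k f := by
  set C : ℝ := Real.exp (Λ * (t + 1)) * (Ω * t * t)
  have hC : Tendsto (fun k : ℕ => C / k) atTop (𝓝 0) := tendsto_const_div_atTop_nhds_zero_nat C
  have hdist : ∀ {k j : ℕ}, k ≠ 0 → j ≠ 0 → (t : ℝ) ≤ k →
      dist (euler X t k f) (euler X t (j * k) f) ≤ C / k := fun hk hj ht =>
    (hX.dist_euler_mul_le f hk hj ht).trans_eq (by ring)
  refine Metric.cauchySeq_iff.2 fun ε hε => ?_
  obtain ⟨N, hN⟩ := eventually_atTop.1 ((hC.eventually_lt_const (half_pos hε)).and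
    ((tendsto_natCast_atTop_atTop.eventually_ge_atTop (t : ℝ)).and (eventually_ne_atTop 0)))
  refine ⟨N, fun k hk j hj => ?_⟩
  obtain ⟨hkε, htk, hk0⟩ := hN k hk
  obtain ⟨hjε, htj, hj0⟩ := hN j hj
  calc dist (euler X t k f) (euler X t j f)
      ≤ dist (euler X t k f) (euler X t (j * k) f) + dist (euler X t j f) (euler X t (j * k) f) :=
        dist_triangle_right _ _ _
    _ ≤ C / k + C / j := add_le_add (hdist hk0 hj0 htk) (mul_comm k j ▸ hdist hj0 hk0 htj)
    _ < ε := by linarith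

theorem exists_isEulerLimit [CompleteSpace M] (hX : IsRegular X Λ Ω B) :
    ∃ F, IsEulerLimit X F := by
  choose F hF using fun f t => cauchySeq_tendsto_of_complete (hX.cauchySeq_euler f t)
  exact ⟨F, hF⟩

end IsRegular

namespace IsEulerLimit

variable {F : M → ℝ≥0 → M}

theorem apply_zero (hF : IsEulerLimit X F) (hX : IsRegular X Λ Ω B) (f : M) : F f 0 = f :=
  tendsto_nhds_unique (hF f 0) (by simpa only [hX.euler_zero] using tendsto_const_nhds)

theorem dist_le (hF : IsEulerLimit X F) (hX : IsRegular X Λ Ω B) (f g : M) (s t : ℝ≥0) :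
    dist (F f s) (F g t) ≤ Real.exp (Λ * t) * (dist f g + B * |(s : ℝ) - t|) :=
  le_of_tendsto' ((hF f s).dist (hF g t)) (hX.dist_euler_le f g s t)

theorem continuous (hF : IsEulerLimit X F) (hX : IsRegular X Λ Ω B) :
    Continuous fun p : M × ℝ≥0 => F p.1 p.2 := by
  refine continuous_iff_continuousAt.2 fun ⟨f, s⟩ => tendsto_iff_dist_tendsto_zero.2 ?_
  refine squeeze_zero (fun _ => dist_nonneg) (fun p => hF.dist_le hX p.1 f p.2 s) ?_
  have hbound : Continuous fun p : M × ℝ≥0 =>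
      Real.exp (Λ * s) * (dist p.1 f + B * |(p.2 : ℝ) - s|) := by fun_prop
  exact hbound.tendsto' _ _ (by simp)

theorem dist_iterate_le (hF : IsEulerLimit X F) (hX : IsRegular X Λ Ω B) (f : M) (h : I) (m : ℕ) :
    dist ((fun g => X g h)^[m] f) (F f (m * toNNReal h)) ≤
      Real.exp (Λ * (m * h + 1)) * (Ω * (m * h) * h) := by
  obtain rfl | hm := eq_or_ne m 0
  · simp [hF.apply_zero hX]
  have hm' : (m : ℝ) ≠ 0 := Nat.cast_ne_zero.2 hm
  have hlim : Tendsto (fun j : ℕ => euler X (m * toNNReal h) (j * m) f) atTop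
      (𝓝 (F f (m * toNNReal h))) :=
    (hF f _).comp (tendsto_id.atTop_mul_const' (Nat.pos_of_ne_zero hm))
  refine le_of_tendsto (tendsto_const_nhds.dist hlim) ?_
  filter_upwards [eventually_ne_atTop 0] with j hj
  rw [← euler_natCast_mul]
  refine (hX.dist_euler_mul_le f hm hj ?_).trans_eq ?_
  · exact mul_le_of_le_one_right (Nat.cast_nonneg m) h.2.2
  · push_cast
    rw [mul_div_cancel_left₀ _ hm', unitInterval.coe_toNNReal]

theorem tendsto_iterate (hF : IsEulerLimit X F) (hX : IsRegular X Λ Ω B) {g : I → M} {m : I → ℕ}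
    {f : M} {t : ℝ≥0} (hg : Tendsto g (𝓝[>] 0) (𝓝 f))
    (hm : Tendsto (fun h => m h * toNNReal h) (𝓝[>] 0) (𝓝 t)) :
    Tendsto (fun h => (fun x => X x h)^[m h] (g h)) (𝓝[>] 0) (𝓝 (F f t)) := by
  have hlim : Tendsto (fun h => F (g h) (m h * toNNReal h)) (𝓝[>] 0) (𝓝 (F f t)) :=
    ((hF.continuous hX).tendsto (f, t)).comp (hg.prodMk_nhds hm)
  refine (tendsto_iff_of_dist (squeeze_zero (fun _ => dist_nonneg)
    (fun h => hF.dist_iterate_le hX (g h) h (m h)) ?_)).2 hlim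
  have hm' : Tendsto (fun h : I => (m h * h : ℝ)) (𝓝[>] 0) (𝓝 t) :=
    (NNReal.continuous_coe.tendsto t).comp hm
  have hh : Tendsto (fun h : I => (h : ℝ)) (𝓝[>] 0) (𝓝 0) :=
    (continuous_subtype_val.tendsto 0).mono_left nhdsWithin_le_nhds
  have hbound := ((Real.continuous_exp.tendsto _).comp ((hm'.add_const 1).const_mul (Λ : ℝ))).mul
    ((hm'.const_mul (Ω : ℝ)).mul hh)
  simpa using hbound

theorem apply_add (hF : IsEulerLimit X F) (hX : IsRegular X Λ Ω B) (f : M) (s t : ℝ≥0) :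
    F (F f s) t = F f (s + t) := by
  have hs := tendsto_floor_div_mul s
  have ht := tendsto_floor_div_mul t
  have hsucc := hF.tendsto_iterate hX (hF.tendsto_iterate hX (tendsto_const_nhds (x := f)) hs) ht
  refine tendsto_nhds_unique hsucc ?_
  simp only [← Function.iterate_add_apply]
  refine hF.tendsto_iterate hX tendsto_const_nhds ?_
  simpa only [Nat.cast_add, add_mul, add_comm s t] using ht.add hs

theorem tangent (hF : IsEulerLimit X F) (hX : IsRegular X Λ Ω B) (f : M) :
    Tendsto (fun h : I => dist (F f (toNNReal h)) (X f h) / (h : ℝ)) (𝓝[>] 0) (𝓝 0) := by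
  have hbound : Continuous fun h : I => Real.exp (Λ * (h + 1)) * (Ω * h) := by fun_prop
  refine squeeze_zero' (Eventually.of_forall fun h => div_nonneg dist_nonneg h.2.1) ?_
    ((hbound.tendsto' 0 0 (by simp)).mono_left nhdsWithin_le_nhds)
  filter_upwards [self_mem_nhdsWithin] with h (hh : (0 : ℝ) < h)
  rw [div_le_iff₀ hh, dist_comm]
  simpa [mul_assoc] using hF.dist_iterate_le hX f h 1

theorem isFlowOf (hF : IsEulerLimit X F) (hX : IsRegular X Λ Ω B) : IsFlowOf X F where
  continuous := hF.continuous hX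
  zero := hF.apply_zero hX
  add := hF.apply_add hX
  tangent f t := by simpa only [hF.apply_add hX] using hF.tangent hX (F f t)

end IsEulerLimit

theorem IsRegular.exists_unique_flow [CompleteSpace M] (hX : IsRegular X Λ Ω B) :
    ∃ F, IsFlowOf X F ∧ (∀ F', IsFlowOf X F' → F' = F) ∧ IsEulerLimit X F := by
  obtain ⟨F, hF⟩ := hX.exists_isEulerLimit
  have hflow := hF.isFlowOf hX
  exact ⟨F, hflow, fun F' hF' => hF'.eq_of_lipschitzWith hX.lipschitz_state hflow, hF⟩

end Regular

section State

variable {n : ℕ}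

theorem State.dist_le_iff {f g : State n} {c : ℝ} (hc : 0 ≤ c) :
    dist f g ≤ c ↔ ∀ x, dist (f.fn x) (g.fn x) ≤ c :=
  UniformFun.dist_le hc

theorem State.dist_fn_le (f g : State n) (x : EuclideanSpace ℝ (Fin n)) :
    dist (f.fn x) (g.fn x) ≤ dist f g :=
  (State.dist_le_iff dist_nonneg).1 le_rfl x

theorem State.norm_coe_fn_le_one (f : State n) (x : EuclideanSpace ℝ (Fin n)) :
    ‖(f.fn x : ℝ)‖ ≤ 1 :=
  (Real.norm_of_nonneg (f.fn x).2.1).trans_le (f.fn x).2.2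

theorem isClosed_setOf_nullMeasurable {α β : Type*} [MeasurableSpace α] {μ : Measure α}
    [PseudoMetricSpace β] [MeasurableSpace β] [BorelSpace β] [SecondCountableTopology β] :
    IsClosed {f : UniformFun α β | NullMeasurable (UniformFun.toFun f) μ} := by
  refine IsSeqClosed.isClosed fun u f hu huf => ?_
  refine (aemeasurable_of_tendsto_metrizable_ae atTop (fun k => (hu k).aemeasurable)
    (Eventually.of_forall fun x => ?_)).nullMeasurable
  exact ((UniformFun.uniformContinuous_eval β x).continuous.tendsto f).comp huf

instance : CompleteSpace (State n) :=
  isClosed_setOf_nullMeasurable.completeSpace_coe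

theorem isClosed_continuousStates : IsClosed (continuousStates n) :=
  (UniformFun.isClosed_setOfPred_continuous (α := EuclideanSpace ℝ (Fin n)) (β := I)).preimage
    continuous_subtype_val

end State

section Convolution

theorem norm_integral_sub_mul_le {G : Type*} [AddCommGroup G] [MeasurableSpace G] [MeasurableAdd G]
    [MeasurableNeg G] {μ : Measure G} [μ.IsAddLeftInvariant] [μ.IsNegInvariant]
    {R : Type*} [NormedRing R] [NormedSpace ℝ R] {K φ : G → R}
    (hK : Integrable K μ) {c : ℝ} (hφ : ∀ y, ‖φ y‖ ≤ c) (x : G) :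
    ‖∫ y, K (x - y) * φ y ∂μ‖ ≤ (∫ y, ‖K y‖ ∂μ) * c := by
  rw [← integral_sub_left_eq_self (fun y => ‖K y‖) μ x, ← integral_mul_const]
  refine norm_integral_le_of_norm_le ((hK.comp_sub_left x).norm.mul_const c)
    (Eventually.of_forall fun y => ?_)
  exact (norm_mul_le _ _).trans <| mul_le_mul_of_nonneg_left (hφ y) (norm_nonneg _)

variable {n : ℕ} {K : EuclideanSpace ℝ (Fin n) → ℝ}

/-- The `L¹` norm of the kernel `K`; every value of `K ∗ f` lies in the closed ball of this
radius. -/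
noncomputable def kernelMass (K : EuclideanSpace ℝ (Fin n) → ℝ) : ℝ≥0 :=
  ⟨∫ y, ‖K y‖, integral_nonneg fun _ => norm_nonneg _⟩

theorem integrable_sub_mul_fn (hK : Integrable K) (f : State n) (x : EuclideanSpace ℝ (Fin n)) :
    Integrable fun y => K (x - y) * (f.fn y : ℝ) :=
  (hK.comp_sub_left x).mul_bdd (aemeasurable_fn f).aestronglyMeasurable
    (Eventually.of_forall f.norm_coe_fn_le_one)

theorem conv_mem_closedBall (hK : Integrable K) (f : State n) (x : EuclideanSpace ℝ (Fin n)) :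
    conv K f x ∈ Metric.closedBall 0 (kernelMass K : ℝ) :=
  mem_closedBall_zero_iff.2
    ((norm_integral_sub_mul_le hK f.norm_coe_fn_le_one x).trans_eq (mul_one _))

theorem dist_conv_le (hK : Integrable K) (f g : State n) (x : EuclideanSpace ℝ (Fin n)) :
    dist (conv K f x) (conv K g x) ≤ kernelMass K * dist f g := by
  rw [dist_eq_norm, conv, conv,
    ← integral_sub (integrable_sub_mul_fn hK f x) (integrable_sub_mul_fn hK g x)]
  simp only [← mul_sub]
  exact norm_integral_sub_mul_le hK (State.dist_fn_le f g) x

theorem continuous_conv (hK : Integrable K) {f : State n} (hf : Continuous f.fn) :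
    Continuous (conv K f) := by
  have hconv : conv K f = convolution (fun y => (f.fn y : ℝ)) K
      (ContinuousLinearMap.mul ℝ ℝ).flip volume := rfl
  rw [hconv]
  exact BddAbove.continuous_convolution_left_of_integrable _
    ⟨1, Set.forall_mem_range.2 f.norm_coe_fn_le_one⟩ (by fun_prop) hK

end Convolution

section LeniaArcField

theorem projIcc_projIcc_add_mul {u s t g : ℝ} (hu : u ∈ I) (hs : 0 ≤ s) (ht : 0 ≤ t) :
    Set.projIcc (0 : ℝ) 1 zero_le_one
        ((Set.projIcc (0 : ℝ) 1 zero_le_one (u + s * g) : ℝ) + t * g) =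
      Set.projIcc (0 : ℝ) 1 zero_le_one (u + (s + t) * g) := by
  obtain ⟨hu0, hu1⟩ := hu
  refine Subtype.ext ?_
  simp only [Set.coe_projIcc, add_mul]
  rcases le_total 0 g with hg | hg
  · have hsg := mul_nonneg hs hg
    have htg := mul_nonneg ht hg
    grind
  · have hsg := mul_nonpos_of_nonneg_of_nonpos hs hg
    have htg := mul_nonpos_of_nonneg_of_nonpos ht hg
    grind

variable {n : ℕ} {K : EuclideanSpace ℝ (Fin n) → ℝ} {G : ℝ → ℝ} {L B : ℝ≥0}

theorem arcField_zero (hK : Integrable K) (hG : Continuous G) (f : State n) :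
    arcField K hK G hG f 0 = f := by
  refine Subtype.ext (UniformFun.toFun.injective (funext fun x => ?_))
  change Set.projIcc (0 : ℝ) 1 zero_le_one (f.fn x + (0 : ℝ) * G (conv K f x)) = f.fn x
  rw [zero_mul, add_zero, Set.projIcc_val]

theorem dist_comp_conv_le (hK : Integrable K)
    (hL : LipschitzOnWith L G (Metric.closedBall 0 (kernelMass K))) (f g : State n)
    (x : EuclideanSpace ℝ (Fin n)) :
    dist (G (conv K f x)) (G (conv K g x)) ≤ L * kernelMass K * dist f g := by
  rw [mul_assoc]
  exact (hL.dist_le_mul _ (conv_mem_closedBall hK f x) _ (conv_mem_closedBall hK g x)).trans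
    (mul_le_mul_of_nonneg_left (dist_conv_le hK f g x) L.2)

theorem lipschitzWith_arcField_state (hK : Integrable K) (hG : Continuous G)
    (hL : LipschitzOnWith L G (Metric.closedBall 0 (kernelMass K))) (t : I) :
    LipschitzWith (1 + L * kernelMass K * toNNReal t) fun f => arcField K hK G hG f t := by
  refine LipschitzWith.of_dist_le_mul fun f g => (State.dist_le_iff (by positivity)).2 fun x => ?_
  calc dist ((arcField K hK G hG f t).fn x) ((arcField K hK G hG g t).fn x)
      ≤ dist (f.fn x + t * G (conv K f x) : ℝ) (g.fn x + t * G (conv K g x)) := dist_projIcc_le _ _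
    _ ≤ dist (f.fn x : ℝ) (g.fn x) + dist (t * G (conv K f x)) (t * G (conv K g x)) :=
        dist_add_add_le _ _ _ _
    _ = dist (f.fn x) (g.fn x) + t * dist (G (conv K f x)) (G (conv K g x)) := by
        rw [Subtype.dist_eq, Real.dist_eq (t * _), ← mul_sub, abs_mul, abs_of_nonneg t.2.1,
          ← Real.dist_eq]
    _ ≤ dist f g + t * (L * kernelMass K * dist f g) :=
        add_le_add (State.dist_fn_le f g x)
          (mul_le_mul_of_nonneg_left (dist_comp_conv_le hK hL f g x) t.2.1)
    _ = (1 + L * kernelMass K * toNNReal t : ℝ≥0) * dist f g := by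
        push_cast
        rw [unitInterval.coe_toNNReal]
        ring

theorem lipschitzWith_arcField_time (hK : Integrable K) (hG : Continuous G)
    (hB : ∀ u ∈ Metric.closedBall (0 : ℝ) (kernelMass K), ‖G u‖ ≤ B) (f : State n) :
    LipschitzWith B (arcField K hK G hG f) := by
  refine LipschitzWith.of_dist_le_mul fun s t => (State.dist_le_iff (by positivity)).2 fun x => ?_
  calc dist ((arcField K hK G hG f s).fn x) ((arcField K hK G hG f t).fn x)
      ≤ dist (f.fn x + s * G (conv K f x) : ℝ) (f.fn x + t * G (conv K f x)) := dist_projIcc_le _ _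
    _ = ‖G (conv K f x)‖ * dist s t := by
        rw [dist_add_left, Real.dist_eq, ← sub_mul, abs_mul, mul_comm]
        rfl
    _ ≤ B * dist s t :=
        mul_le_mul_of_nonneg_right (hB _ (conv_mem_closedBall hK f x)) dist_nonneg

/-- Clipping in two steps along a frozen velocity agrees with clipping once, so the semigroup
defect comes only from evaluating `G ∘ (K ∗ ·)` at `X_s(f)` instead of `f`. -/
theorem dist_arcField_add_le (hK : Integrable K) (hG : Continuous G)
    (hL : LipschitzOnWith L G (Metric.closedBall 0 (kernelMass K)))
    (hB : ∀ u ∈ Metric.closedBall (0 : ℝ) (kernelMass K), ‖G u‖ ≤ B) (f : State n) {s t r : I}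
    (hr : (r : ℝ) = s + t) :
    dist (arcField K hK G hG f r) (arcField K hK G hG (arcField K hK G hG f s) t) ≤
      (L * kernelMass K * B : ℝ≥0) * (s * t) := by
  have hs : (0 : ℝ) ≤ s := s.2.1
  have ht : (0 : ℝ) ≤ t := t.2.1
  set g := arcField K hK G hG f s with hg
  have hdist : dist f g ≤ B * s := by
    simpa [arcField_zero, hg, Subtype.dist_eq, abs_of_nonneg hs] using
      (lipschitzWith_arcField_time hK hG hB f).dist_le_mul 0 s
  refine (State.dist_le_iff (by positivity)).2 fun x => ?_
  have hfn : (arcField K hK G hG f r).fn x =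
      Set.projIcc (0 : ℝ) 1 zero_le_one (g.fn x + t * G (conv K f x)) := by
    refine Eq.trans ?_ (projIcc_projIcc_add_mul (f.fn x).2 hs ht).symm
    rw [← hr]
    rfl
  rw [hfn]
  calc dist (Set.projIcc (0 : ℝ) 1 zero_le_one (g.fn x + t * G (conv K f x)))
        ((arcField K hK G hG g t).fn x)
      ≤ dist (g.fn x + t * G (conv K f x) : ℝ) (g.fn x + t * G (conv K g x)) := dist_projIcc_le _ _
    _ = t * dist (G (conv K f x)) (G (conv K g x)) := by
        rw [dist_add_left, Real.dist_eq, ← mul_sub, abs_mul, abs_of_nonneg ht, ← Real.dist_eq]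
    _ ≤ t * (L * kernelMass K * (B * s)) := by
        gcongr
        exact (dist_comp_conv_le hK hL f g x).trans (by gcongr)
    _ = (L * kernelMass K * B : ℝ≥0) * (s * t) := by push_cast; ring

theorem exists_isRegular_arcField (hK : Integrable K) (hG : LocallyLipschitz G) :
    ∃ Λ Ω B, IsRegular (arcField K hK G hG.continuous) Λ Ω B := by
  have hcompact : IsCompact (Metric.closedBall (0 : ℝ) (kernelMass K)) :=
    isCompact_closedBall _ _
  obtain ⟨L, hL⟩ := hG.locallyLipschitzOn.exists_lipschitzOnWith_of_compact hcompact
  obtain ⟨C, hC⟩ := hcompact.exists_bound_of_continuousOn hG.continuous.continuousOn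
  have hB : ∀ u ∈ Metric.closedBall (0 : ℝ) (kernelMass K), ‖G u‖ ≤ C.toNNReal :=
    fun u hu => (hC u hu).trans C.le_coe_toNNReal
  exact ⟨_, _, _, arcField_zero hK hG.continuous,
    lipschitzWith_arcField_state hK hG.continuous hL,
    lipschitzWith_arcField_time hK hG.continuous hB,
    fun f _ _ _ => dist_arcField_add_le hK hG.continuous hL hB f⟩

theorem arcField_mem_continuousStates (hK : Integrable K) (hG : Continuous G) {f : State n}
    (hf : f ∈ continuousStates n) (t : I) : arcField K hK G hG f t ∈ continuousStates n := by
  have hfn : Continuous f.fn := hf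
  have hconv := continuous_conv hK hfn
  have hsum : Continuous fun x => (f.fn x : ℝ) + t * G (conv K f x) := by fun_prop
  exact (continuous_projIcc (h := zero_le_one)).comp hsum

end LeniaArcField

end Lenia

open Lenia in
theorem mainTheorem6_general (n : ℕ) (K : EuclideanSpace ℝ (Fin n) → ℝ) (hK : Integrable K)
    (G : ℝ → ℝ) (hG : LocallyLipschitz G) :
    IsArcField (arcField K hK G hG.continuous) ∧
    (∃ F : State n → ℝ≥0 → State n,
      IsFlowOf (arcField K hK G hG.continuous) F ∧
      (∀ F', IsFlowOf (arcField K hK G hG.continuous) F' → F' = F) ∧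
      (∀ f₀ t, Tendsto (fun k => euler (arcField K hK G hG.continuous) t k f₀) atTop
        (𝓝 (F f₀ t))) ∧
      (∀ f₀ : State n, Continuous f₀.fn → ∀ t, 0 < t → Continuous (F f₀ t).fn)) ∧
    IsClosed (continuousStates n) ∧
    RestrictsTo (arcField K hK G hG.continuous) (continuousStates n) ∧
    (∀ f₀ ∈ continuousStates n, ∀ t g,
      Tendsto (fun k => euler (arcField K hK G hG.continuous) t k f₀) atTop (𝓝 g) →
        g ∈ continuousStates n) := by
  obtain ⟨Λ, Ω, B, hX⟩ := exists_isRegular_arcField hK hG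
  obtain ⟨F, hflow, hunique, heuler⟩ := hX.exists_unique_flow
  have hmaps : ∀ f ∈ continuousStates n, ∀ t,
      arcField K hK G hG.continuous f t ∈ continuousStates n :=
    fun f hf => arcField_mem_continuousStates hK hG.continuous hf
  have hlim : ∀ f₀ ∈ continuousStates n, ∀ t g,
      Tendsto (fun k => euler (arcField K hK G hG.continuous) t k f₀) atTop (𝓝 g) →
        g ∈ continuousStates n :=
    fun f₀ hf₀ t g => mem_of_tendsto_euler isClosed_continuousStates hmaps hf₀
  exact ⟨hX.isArcField,
    ⟨F, hflow, hunique, heuler, fun f₀ hf₀ t _ => hlim f₀ hf₀ t _ (heuler f₀ t)⟩,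
    isClosed_continuousStates, hX.isArcField.restrictsTo hmaps, hlim⟩

theorem mainTheorem6 (n : ℕ)
    (K : EuclideanSpace ℝ (Fin n) → ℝ) (hK : MeasureTheory.Integrable K MeasureTheory.volume)
    (G : ℝ → ℝ) (hGb : ∃ B : ℝ, ∀ u, |G u| ≤ B) (L : ℝ≥0) (hG : LipschitzWith L G) :
    -- the Lenia solutions are well defined: the arc field has exactly one flow `F`,
    -- and `F` is the limit of the Euler curves
    Lenia.IsArcField (Lenia.arcField K hK G hG.continuous) ∧
    (∃ F : Lenia.State n → ℝ≥0 → Lenia.State n,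
      Lenia.IsFlowOf (Lenia.arcField K hK G hG.continuous) F ∧
      (∀ F' : Lenia.State n → ℝ≥0 → Lenia.State n,
        Lenia.IsFlowOf (Lenia.arcField K hK G hG.continuous) F' → F' = F) ∧
      (∀ (f₀ : Lenia.State n) (t : ℝ≥0),
        Filter.Tendsto (fun k : ℕ => Lenia.euler (Lenia.arcField K hK G hG.continuous) t k f₀)
          Filter.atTop (nhds (F f₀ t))) ∧
      -- the solution `F f₀ t` is continuous whenever `f₀` is
      (∀ f₀ : Lenia.State n, Continuous f₀.fn → ∀ t : ℝ≥0, 0 < t → Continuous (F f₀ t).fn)) ∧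
    -- the continuous states form a closed subspace, to which the arc field restricts,
    -- and limits of Euler curves stay in it
    IsClosed (Lenia.continuousStates n) ∧
    Lenia.RestrictsTo (Lenia.arcField K hK G hG.continuous) (Lenia.continuousStates n) ∧
    (∀ f₀ ∈ Lenia.continuousStates n, ∀ (t : ℝ≥0) (g : Lenia.State n),
      Filter.Tendsto (fun k : ℕ => Lenia.euler (Lenia.arcField K hK G hG.continuous) t k f₀)
        Filter.atTop (nhds g) → g ∈ Lenia.continuousStates n) := by
  exact mainTheorem6_general n K hK G hG.locallyLipschitz
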